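/- **Theorem 3.6.** Let $E$ be a real Banach lattice. For $A \subset E$ let $\mathrm{Sol}(A) = \{y \in E : |y| \le |x| \text{ for some } x \in A\}$ be its solid hull. A norm bounded set $A \subset E$ is called *disjointly weakly compact* if $x_n \to 0$ weakly for every sequence $(x_n)$ in $\mathrm{Sol}(A)$ that is disjoint, i.e. satisfies $|x_m| \wedge |x_n| = 0$ for $m \neq n$. A bounded linear operator $T : X \to E$ from a real Banach space $X$ is called *disjointly weakly compact* if the image $T(B_X)$ of the closed unit ball of $X$ is a disjointly weakly compact set. The norm of the dual Banach lattice $E'$ (ordered by $f \le g$ if and only if $f(x) \le g(x)$ for all $x \ge 0$ in $E$) is *order continuous* if $\|f_\alpha\| \to 0$ for every decreasing net $(f_\alpha)$ in $E'$ with infimum $0$. The following statements are equivalent. 1. Every bounded linear operator $T : X \to E$ from an arbitrary real Banach space $X$ into $E$ is disjointly weakly compact. 2. Every bounded linear operator $T : \ell_1 \to E$ is disjointly weakly compact. 3. The norm of $E'$ is order continuous. -/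

import Mathlib

open Filter Topology

universe u w

/-- A sequence is disjoint if its terms are pairwise disjoint: `|x m| ∧ |x n| = 0` for `m ≠ n`. -/
def IsDisjointSeq {E : Type*} [Lattice E] [AddCommGroup E] (x : ℕ → E) : Prop :=
  ∀ m n : ℕ, m ≠ n → |x m| ⊓ |x n| = 0

/-- A subset `A` of a Banach lattice is disjointly weakly compact if it is norm bounded and every
disjoint sequence in its solid hull converges weakly to zero. -/
def IsDisjointlyWeaklyCompact {E : Type*} [NormedAddCommGroup E] [NormedSpace ℝ E] [Lattice E]
    (A : Set E) : Prop :=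
  Bornology.IsBounded A ∧
    ∀ x : ℕ → E, (∀ n, x n ∈ LatticeOrderedAddCommGroup.solidClosure A) → IsDisjointSeq x →
      Tendsto (fun n => toWeakSpace ℝ E (x n)) atTop (𝓝 0)

/-- A bounded operator from a Banach space to a Banach lattice is disjointly weakly compact if it
maps the closed unit ball onto a disjointly weakly compact set. -/
def IsDisjointlyWeaklyCompactOperator {X E : Type*} [NormedAddCommGroup X] [NormedSpace ℝ X]
    [NormedAddCommGroup E] [NormedSpace ℝ E] [Lattice E] (T : X →L[ℝ] E) : Prop :=
  IsDisjointlyWeaklyCompact (T '' Metric.closedBall (0 : X) 1)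

/-- The norm is order continuous if every downward directed set `D` with infimum `0`, regarded as
a decreasing net indexed by itself, converges to `0` in norm. -/
def HasOrderContinuousNorm (F : Type*) [NormedAddCommGroup F] [PartialOrder F] : Prop :=
  ∀ D : Set F, D.Nonempty → DirectedOn (fun x y => y ≤ x) D → IsGLB D 0 →
    ∀ ε : ℝ, 0 < ε → ∃ x ∈ D, ∀ y ∈ D, y ≤ x → ‖y‖ < ε

/-- The order of the dual Banach lattice: `f ≤ g` if and only if `f x ≤ g x` for all `x ≥ 0`. -/
abbrev dualPartialOrder (E : Type*) [NormedAddCommGroup E] [NormedSpace ℝ E] [Lattice E]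
    [IsOrderedAddMonoid E] : PartialOrder (StrongDual ℝ E) where
  le f g := ∀ x : E, 0 ≤ x → f x ≤ g x
  le_refl _ _ _ := le_rfl
  le_trans _ _ _ hfg hgh x hx := (hfg x hx).trans (hgh x hx)
  le_antisymm f g hfg hgf := by
    ext x
    rw [← posPart_sub_negPart x, map_sub, map_sub,
      le_antisymm (hfg _ (posPart_nonneg x)) (hgf _ (posPart_nonneg x)),
      le_antisymm (hfg _ (negPart_nonneg x)) (hgf _ (negPart_nonneg x))]

/-- The dual `E'`, with its operator norm and its dual order, has order continuous norm. -/
def DualHasOrderContinuousNorm (E : Type*) [NormedAddCommGroup E] [NormedSpace ℝ E] [Lattice E]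
    [IsOrderedAddMonoid E] : Prop :=
  letI : PartialOrder (StrongDual ℝ E) := dualPartialOrder E
  HasOrderContinuousNorm (StrongDual ℝ E)

/-! Statement 3 amounts to this: every norm bounded disjoint sequence is weakly null. If E' has
order continuous norm, it suffices to test a positive functional f on a positive bounded disjoint
sequence (u n). The components g n of f along u n have partial sums below f, so the tails of their
series decrease to 0. Order continuity makes the tails, hence ‖g n‖, tend to 0, and f (u n) ≤ ‖g n‖
‖u n‖ (`tendsto_apply_of_disjoint_of_nonneg`). The image of a ball has bounded solid hull, so every
operator qualifies. Conversely, a positive disjoint sequence in the unit ball is the image of the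
unit vectors under some operator on ℓ¹, so statement 2 makes it weakly null. Then, for f ≥ 0, the
positive part of the ball lies below a single u up to an excess small for f
(`exists_forall_apply_posPart_sub_le`). Pointwise decrease to 0 at u thus becomes uniform decrease
on the ball. -/

namespace BanachLattice

/-! ### Disjointness in lattice-ordered groups -/

section Order

variable {E : Type*} [AddCommGroup E] [Lattice E] [IsOrderedAddMonoid E]

lemma inf_add_le_inf_add_inf {a b c : E} (ha : 0 ≤ a) (hb : 0 ≤ b) (hc : 0 ≤ c) :
    a ⊓ (b + c) ≤ a ⊓ b + a ⊓ c := by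
  rw [add_inf, inf_add, inf_add]
  refine le_inf (le_inf ?_ ?_) (le_inf ?_ ?_)
  · exact inf_le_left.trans (le_add_of_nonneg_left ha)
  · exact inf_le_left.trans (le_add_of_nonneg_left hb)
  · exact inf_le_left.trans (le_add_of_nonneg_right hc)
  · exact inf_le_right

omit [IsOrderedAddMonoid E] in
lemma inf_eq_zero_of_le {a b c d : E} (ha : 0 ≤ a) (hb : 0 ≤ b) (hac : a ≤ c) (hbd : b ≤ d)
    (h : c ⊓ d = 0) : a ⊓ b = 0 :=
  le_antisymm ((inf_le_inf hac hbd).trans h.le) (le_inf ha hb)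

lemma inf_sum_eq_zero {ι : Type*} {a : E} {b : ι → E} (s : Finset ι) (ha : 0 ≤ a)
    (hb : ∀ i ∈ s, 0 ≤ b i) (h : ∀ i ∈ s, a ⊓ b i = 0) : a ⊓ ∑ i ∈ s, b i = 0 := by
  classical
  induction s using Finset.induction_on with
  | empty => simpa using ha
  | insert i s hi ih =>
    rw [Finset.sum_insert hi]
    have hs : 0 ≤ ∑ j ∈ s, b j :=
      Finset.sum_nonneg fun j hj => hb j (Finset.mem_insert_of_mem hj)
    have hbi := hb i (Finset.mem_insert_self _ _)
    refine le_antisymm ((inf_add_le_inf_add_inf ha hbi hs).trans ?_)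
      (le_inf ha (add_nonneg hbi hs))
    rw [h i (Finset.mem_insert_self _ _), ih (fun j hj => hb j (Finset.mem_insert_of_mem hj))
      (fun j hj => h j (Finset.mem_insert_of_mem hj)), add_zero]

lemma inf_nsmul_eq_zero {a b : E} (ha : 0 ≤ a) (hb : 0 ≤ b) (h : a ⊓ b = 0) (k : ℕ) :
    a ⊓ k • b = 0 := by
  simpa using inf_sum_eq_zero (Finset.range k) (b := fun _ => b) ha (fun _ _ => hb) (fun _ _ => h)

/-- A sum of pairwise disjoint positive elements below `x` is below `x`. -/
lemma sum_le_of_disjoint {a : ℕ → E} {x : E} (hx : 0 ≤ x) (ha : ∀ n, 0 ≤ a n)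
    (hax : ∀ n, a n ≤ x) (hd : ∀ m n, m ≠ n → a m ⊓ a n = 0) (N : ℕ) :
    ∑ n ∈ Finset.range N, a n ≤ x := by
  induction N with
  | zero => simpa using hx
  | succ N ih =>
    have h : a N ⊓ ∑ n ∈ Finset.range N, a n = 0 :=
      inf_sum_eq_zero _ (ha N) (fun i _ => ha i)
        (fun i hi => hd N i (Finset.mem_range.mp hi).ne')
    rw [Finset.sum_range_succ, add_comm, ← inf_add_sup, h, zero_add]
    exact sup_le (hax N) ih

lemma posPart_add_le (a b : E) : (a + b)⁺ ≤ a⁺ + b⁺ :=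
  sup_le (add_le_add (le_posPart a) (le_posPart b))
    (add_nonneg (posPart_nonneg a) (posPart_nonneg b))

end Order

variable {E : Type*} [NormedAddCommGroup E] [NormedSpace ℝ E] [Lattice E]
  [IsOrderedAddMonoid E] [HasSolidNorm E]

/-! ### Constructing and decomposing functionals -/

omit [NormedSpace ℝ E] in
lemma norm_le_norm_of_nonneg_of_le {a b : E} (ha : 0 ≤ a) (hab : a ≤ b) : ‖a‖ ≤ ‖b‖ :=
  norm_le_norm_of_abs_le_abs (by rwa [abs_of_nonneg ha, abs_of_nonneg (ha.trans hab)])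

/-- An additive norm bounded function on the positive cone extends to a bounded functional. -/
lemma exists_dual_of_additive (p : E → ℝ) (C : ℝ)
    (hadd : ∀ x y, 0 ≤ x → 0 ≤ y → p (x + y) = p x + p y) (hC : ∀ x, 0 ≤ x → |p x| ≤ C * ‖x‖) :
    ∃ g : StrongDual ℝ E, ∀ x, 0 ≤ x → g x = p x := by
  have h0 : p 0 = 0 := by simpa using hadd 0 0 le_rfl le_rfl
  let g₀ : E →+ ℝ :=
    { toFun := fun x => p x⁺ - p x⁻
      map_zero' := by simp
      map_add' := by
        intro x y
        -- Written without subtraction, so that additivity on the cone applies to both sides.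
        have e : (x + y)⁺ + (x⁻ + y⁻) = (x + y)⁻ + (x⁺ + y⁺) := by
          have hx := posPart_sub_negPart x
          have hy := posPart_sub_negPart y
          have hxy := posPart_sub_negPart (x + y)
          rw [← sub_eq_zero]
          calc (x + y)⁺ + (x⁻ + y⁻) - ((x + y)⁻ + (x⁺ + y⁺))
              = ((x + y)⁺ - (x + y)⁻) - (x⁺ - x⁻) - (y⁺ - y⁻) := by abel
            _ = 0 := by rw [hx, hy, hxy]; abel
        have e' := congrArg p e
        have hxp := posPart_nonneg x
        have hxn := negPart_nonneg x
        have hyp := posPart_nonneg y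
        have hyn := negPart_nonneg y
        rw [hadd _ _ (posPart_nonneg _) (add_nonneg hxn hyn), hadd _ _ hxn hyn,
          hadd _ _ (negPart_nonneg _) (add_nonneg hxp hyp), hadd _ _ hxp hyp] at e'
        linarith }
  have hcont : Continuous g₀ := by
    refine AddMonoidHomClass.continuous_of_bound g₀ (2 * |C|) fun x => ?_
    have key : ∀ z : E, 0 ≤ z → z ≤ |x| → |p z| ≤ |C| * ‖x‖ := fun z hz hzx =>
      (hC z hz).trans ((mul_le_mul_of_nonneg_right (le_abs_self C) (norm_nonneg z)).trans
        (mul_le_mul_of_nonneg_left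
          ((norm_le_norm_of_nonneg_of_le hz hzx).trans (norm_abs_eq_norm x).le) (abs_nonneg C)))
    have h1 := key x⁺ (posPart_nonneg x) (sup_le (le_abs_self x) (abs_nonneg x))
    have h2 := key x⁻ (negPart_nonneg x) (sup_le (neg_le_abs x) (abs_nonneg x))
    calc ‖g₀ x‖ = |p x⁺ - p x⁻| := rfl
      _ ≤ |p x⁺| + |p x⁻| := abs_sub _ _
      _ ≤ 2 * |C| * ‖x‖ := by linarith
  refine ⟨g₀.toRealLinearMap hcont, fun x hx => ?_⟩
  change p x⁺ - p x⁻ = p x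
  rw [posPart_eq_self.mpr hx, negPart_eq_zero.mpr hx, h0, sub_zero]


/-- Superadditivity may cost a doubling of the index, since n and 2n give the same limit. This fits
truncations x ⊓ n • u, where two multiples n • u add up to 2n • u. -/
lemma exists_dual_of_monotone_limit (f : StrongDual ℝ E) (q : ℕ → E → ℝ)
    (hmono : ∀ x, 0 ≤ x → Monotone fun n => q n x) (h0 : ∀ n x, 0 ≤ x → 0 ≤ q n x)
    (hle : ∀ n x, 0 ≤ x → q n x ≤ f x)
    (hsub : ∀ n x y, 0 ≤ x → 0 ≤ y → q n (x + y) ≤ q n x + q n y)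
    (hsup : ∀ n x y, 0 ≤ x → 0 ≤ y → q n x + q n y ≤ q (2 * n) (x + y)) :
    ∃ g : StrongDual ℝ E, ∀ x, 0 ≤ x → Tendsto (fun n => q n x) atTop (𝓝 (g x)) := by
  have hlim : ∀ x, 0 ≤ x → Tendsto (fun n => q n x) atTop (𝓝 (⨆ n, q n x)) := fun x hx =>
    tendsto_atTop_ciSup (hmono x hx) ⟨f x, by rintro _ ⟨n, rfl⟩; exact hle n x hx⟩
  refine (exists_dual_of_additive (fun x => ⨆ n, q n x) ‖f‖ ?_ ?_).imp
    fun g hg x hx => by rw [hg x hx]; exact hlim x hx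
  · intro x y hx hy
    have hxy := hlim _ (add_nonneg hx hy)
    have hs := (hlim x hx).add (hlim y hy)
    refine le_antisymm (le_of_tendsto_of_tendsto' hxy hs fun n => hsub n x y hx hy)
      (le_of_tendsto_of_tendsto' hs
        (hxy.comp (tendsto_id.const_mul_atTop' (two_pos))) fun n => hsup n x y hx hy)
  · intro x hx
    have h1 : 0 ≤ ⨆ n, q n x := ge_of_tendsto' (hlim x hx) fun n => h0 n x hx
    have h2 : ⨆ n, q n x ≤ f x := le_of_tendsto' (hlim x hx) fun n => hle n x hx
    rw [abs_of_nonneg h1]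
    exact h2.trans ((le_abs_self _).trans (f.le_opNorm x))

omit [HasSolidNorm E] in
lemma apply_mono {f : StrongDual ℝ E} (hf : ∀ x, 0 ≤ x → 0 ≤ f x) {x y : E} (h : x ≤ y) :
    f x ≤ f y := by
  have := hf (y - x) (sub_nonneg.mpr h)
  rw [map_sub] at this
  linarith

lemma norm_le_of_nonneg_of_le {f : StrongDual ℝ E} {C : ℝ} (hC : 0 ≤ C)
    (hf : ∀ x, 0 ≤ x → 0 ≤ f x) (h : ∀ x, 0 ≤ x → f x ≤ C * ‖x‖) : ‖f‖ ≤ C := by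
  refine f.opNorm_le_bound hC fun x => ?_
  have h1 := apply_mono hf (le_abs_self x)
  have h2 := apply_mono hf (neg_le_abs x)
  rw [map_neg] at h2
  have h3 := h |x| (abs_nonneg x)
  rw [norm_abs_eq_norm] at h3
  exact (abs_le'.mpr ⟨h1, h2⟩).trans h3

/-- The component of a positive functional in the band generated by a positive element. -/
lemma exists_component {f : StrongDual ℝ E} (hf : ∀ x, 0 ≤ x → 0 ≤ f x) {u : E} (hu : 0 ≤ u) :
    ∃ g : StrongDual ℝ E,
      ∀ x, 0 ≤ x → Tendsto (fun k : ℕ => f (x ⊓ k • u)) atTop (𝓝 (g x)) := by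
  have hku : ∀ k : ℕ, 0 ≤ k • u := fun k => nsmul_nonneg hu k
  refine exists_dual_of_monotone_limit f (fun k x => f (x ⊓ k • u)) ?_ ?_ ?_ ?_ ?_
  · intro x _ m n hmn
    exact apply_mono hf (inf_le_inf_left _ (nsmul_le_nsmul_left hu hmn))
  · exact fun n x hx => hf _ (le_inf hx (hku n))
  · exact fun n x _ => apply_mono hf inf_le_left
  · intro n x y hx hy
    rw [← map_add]
    apply apply_mono hf
    rw [inf_comm, inf_comm x, inf_comm y]
    exact inf_add_le_inf_add_inf (hku n) hx hy
  · intro n x y hx hy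
    simp only [← map_add]
    refine apply_mono hf (le_inf (add_le_add inf_le_left inf_le_left) ?_)
    rw [two_mul, add_nsmul]
    exact add_le_add inf_le_right inf_le_right

/-- Every bounded functional is a difference of positive ones. -/
lemma exists_pos_sub_pos (f : StrongDual ℝ E) : ∃ g h : StrongDual ℝ E,
    (∀ x, 0 ≤ x → 0 ≤ g x) ∧ (∀ x, 0 ≤ x → 0 ≤ h x) ∧ f = g - h := by
  have hbd : ∀ x : E, ∀ y : Set.Icc (0 : E) x, f y ≤ ‖f‖ * ‖x‖ := fun x y =>
    (le_abs_self _).trans ((f.le_opNorm _).trans (mul_le_mul_of_nonneg_left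
      (norm_le_norm_of_nonneg_of_le y.2.1 y.2.2) (norm_nonneg f)))
  have hbdd : ∀ x : E, BddAbove (Set.range fun y : Set.Icc (0 : E) x => f y) := fun x =>
    ⟨‖f‖ * ‖x‖, by rintro _ ⟨y, rfl⟩; exact hbd x y⟩
  have hpos : ∀ x, 0 ≤ x → 0 ≤ ⨆ y : Set.Icc (0 : E) x, f y := fun x hx => by
    simpa using le_ciSup (hbdd x) ⟨0, le_rfl, hx⟩
  refine (exists_dual_of_additive (fun x => ⨆ y : Set.Icc (0 : E) x, f y) ‖f‖ ?_ ?_).imp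
    fun g hg => ⟨g - f, fun x hx => (hpos x hx).trans (hg x hx).ge, fun x hx => ?_, by abel⟩
  rotate_left 2
  · rw [sub_apply, hg x hx]
    exact sub_nonneg.mpr (le_ciSup (hbdd x) ⟨x, hx, le_rfl⟩)
  · intro x y hx hy
    have : Nonempty (Set.Icc (0 : E) x) := ⟨⟨0, le_rfl, hx⟩⟩
    have : Nonempty (Set.Icc (0 : E) y) := ⟨⟨0, le_rfl, hy⟩⟩
    have : Nonempty (Set.Icc (0 : E) (x + y)) := ⟨⟨0, le_rfl, add_nonneg hx hy⟩⟩
    apply le_antisymm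
    · refine ciSup_le ?_
      rintro ⟨z, hz0, hz⟩
      -- Riesz decomposition: the summands lie in [0, x] and [0, y].
      have hsplit : z = z ⊓ x + (z - x)⁺ := by rw [inf_eq_sub_posPart_sub]; abel
      have h1 : f (z ⊓ x) ≤ ⨆ y : Set.Icc (0 : E) x, f y :=
        le_ciSup (hbdd x) ⟨z ⊓ x, le_inf hz0 hx, inf_le_right⟩
      have h2 : f (z - x)⁺ ≤ ⨆ z : Set.Icc (0 : E) y, f z :=
        le_ciSup (hbdd y) ⟨(z - x)⁺, posPart_nonneg _, sup_le (sub_le_iff_le_add'.mpr hz) hy⟩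
      calc f z = f (z ⊓ x) + f (z - x)⁺ := by rw [← map_add, ← hsplit]
        _ ≤ _ := add_le_add h1 h2
    · refine ciSup_add_ciSup_le fun a b => ?_
      rw [← map_add]
      exact le_ciSup (hbdd (x + y))
        ⟨(a : E) + b, add_nonneg a.2.1 b.2.1, add_le_add a.2.2 b.2.2⟩
  · intro x hx
    have : Nonempty (Set.Icc (0 : E) x) := ⟨⟨0, le_rfl, hx⟩⟩
    rw [abs_of_nonneg (hpos x hx)]
    exact ciSup_le (hbd x)

/-! ### Order continuous dual norm makes bounded disjoint sequences weakly null -/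

/-- If the dual norm is order continuous, positive functionals vanish along bounded disjoint
sequences of positive elements. -/
lemma tendsto_apply_of_disjoint_of_nonneg (hE : DualHasOrderContinuousNorm E)
    {f : StrongDual ℝ E} (hf : ∀ x, 0 ≤ x → 0 ≤ f x) {u : ℕ → E} (hu : ∀ n, 0 ≤ u n)
    {C : ℝ} (hC : ∀ n, ‖u n‖ ≤ C) (hd : ∀ m n, m ≠ n → u m ⊓ u n = 0) :
    Tendsto (fun n => f (u n)) atTop (𝓝 0) := by
  choose g hg using fun n => exists_component hf (hu n)
  have hgpos : ∀ n x, 0 ≤ x → 0 ≤ g n x := fun n x hx =>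
    ge_of_tendsto' (hg n x hx) fun k => hf _ (le_inf hx (nsmul_nonneg (hu n) k))
  have hgu : ∀ n, f (u n) ≤ g n (u n) := fun n => by
    refine ge_of_tendsto (hg n _ (hu n)) ((eventually_ge_atTop 1).mono fun k hk => ?_)
    refine apply_mono hf (le_inf le_rfl ?_)
    simpa using nsmul_le_nsmul_left (hu n) hk
  -- For fixed k the truncations x ⊓ k • u n are pairwise disjoint and below x, so their sum is too.
  have hsum : ∀ N x, 0 ≤ x → ∑ n ∈ Finset.range N, g n x ≤ f x := fun N x hx => by
    refine le_of_tendsto' (tendsto_finsetSum _ fun n _ => hg n x hx) fun k => ?_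
    rw [← map_sum]
    refine apply_mono hf (sum_le_of_disjoint hx
      (fun n => le_inf hx (nsmul_nonneg (hu n) k)) (fun n => inf_le_left) (fun m n hmn => ?_) N)
    have hk : ∀ n, 0 ≤ k • u n := fun n => nsmul_nonneg (hu n) k
    refine inf_eq_zero_of_le (le_inf hx (hk m)) (le_inf hx (hk n)) inf_le_right inf_le_right ?_
    refine inf_nsmul_eq_zero (hk m) (hu n) ?_ k
    rw [inf_comm]
    exact inf_nsmul_eq_zero (hu n) (hu m) (hd n m hmn.symm) k
  obtain ⟨G, hG⟩ := exists_dual_of_monotone_limit f (fun N x => ∑ n ∈ Finset.range N, g n x)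
    (fun x hx => monotone_nat_of_le_succ fun N => by
      rw [Finset.sum_range_succ]; exact le_add_of_nonneg_right (hgpos N x hx))
    (fun N x hx => Finset.sum_nonneg fun n _ => hgpos n x hx) hsum
    (fun N x y _ _ => by simp [Finset.sum_add_distrib])
    (fun N x y hx hy => by
      rw [← Finset.sum_add_distrib]
      simp only [← map_add]
      exact Finset.sum_le_sum_of_subset_of_nonneg
        (Finset.range_mono (by omega)) fun n _ _ => hgpos n _ (add_nonneg hx hy))
  let r : ℕ → StrongDual ℝ E := fun N => G - ∑ n ∈ Finset.range N, g n
  have hr : ∀ N x, r N x = G x - ∑ n ∈ Finset.range N, g n x := fun N x => by simp [r]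
  have hrlim : ∀ x, 0 ≤ x → Tendsto (fun N => r N x) atTop (𝓝 0) := fun x hx => by
    simpa [hr] using (hG x hx).const_sub (G x)
  let _ := dualPartialOrder E
  have hranti : Antitone r := antitone_nat_of_succ_le fun N x hx => by
    rw [hr, hr, Finset.sum_range_succ]
    have := hgpos N x hx
    linarith
  have hglb : IsGLB (Set.range r) 0 := by
    constructor
    · rintro _ ⟨N, rfl⟩ x hx
      refine le_of_tendsto (hrlim x hx) ((eventually_ge_atTop N).mono fun M hM => ?_)
      exact hranti hM x hx
    · exact fun h hh x hx => ge_of_tendsto' (hrlim x hx) fun N => hh ⟨N, rfl⟩ x hx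
  have hdir : DirectedOn (fun x y => y ≤ x) (Set.range r) := by
    rintro _ ⟨M, rfl⟩ _ ⟨N, rfl⟩
    exact ⟨_, ⟨max M N, rfl⟩, hranti (le_max_left _ _), hranti (le_max_right _ _)⟩
  have hC0 : 0 ≤ C := (norm_nonneg _).trans (hC 0)
  rw [Metric.tendsto_atTop]
  intro ε hε
  -- Half of ε / (C + 1), because g n is a difference of two tails; C + 1 avoids dividing by 0.
  obtain ⟨_, ⟨N, rfl⟩, hN⟩ :=
    hE (Set.range r) ⟨_, 0, rfl⟩ hdir hglb (ε / (2 * (C + 1))) (by positivity)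
  refine ⟨N, fun n hn => ?_⟩
  have h1 := hN _ ⟨n, rfl⟩ (hranti hn)
  have h2 := hN _ ⟨n + 1, rfl⟩ (hranti (hn.trans n.le_succ))
  have hgn : g n = r n - r (n + 1) := by simp only [r, Finset.sum_range_succ]; abel
  have h3 : ‖g n‖ < ε / (C + 1) := by
    rw [hgn]
    calc _ ≤ ‖r n‖ + ‖r (n + 1)‖ := norm_sub_le _ _
      _ < ε / (2 * (C + 1)) + ε / (2 * (C + 1)) := add_lt_add h1 h2
      _ = ε / (C + 1) := by field_simp; norm_num
  rw [Real.dist_eq, sub_zero, abs_of_nonneg (hf _ (hu n))]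
  calc f (u n) ≤ g n (u n) := hgu n
    _ ≤ ‖g n‖ * ‖u n‖ := (le_abs_self _).trans ((g n).le_opNorm _)
    _ ≤ ‖g n‖ * (C + 1) :=
      mul_le_mul_of_nonneg_left ((hC n).trans (by linarith)) (norm_nonneg _)
    _ < ε := (lt_div_iff₀ (by linarith)).mp h3

lemma tendsto_weak_of_isDisjointSeq (hE : DualHasOrderContinuousNorm E) {x : ℕ → E} {C : ℝ}
    (hC : ∀ n, ‖x n‖ ≤ C) (hd : IsDisjointSeq x) :
    Tendsto (fun n => toWeakSpace ℝ E (x n)) atTop (𝓝 0) := by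
  have key : ∀ f : StrongDual ℝ E, (∀ y, 0 ≤ y → 0 ≤ f y) →
      Tendsto (fun n => f (x n)) atTop (𝓝 0) := fun f hf => by
    have hp := tendsto_apply_of_disjoint_of_nonneg hE hf (u := fun n => |x n|)
      (fun n => abs_nonneg _) (fun n => (norm_abs_eq_norm (x n)).trans_le (hC n)) hd
    refine squeeze_zero_norm (fun n => ?_) hp
    have h2 := apply_mono hf (neg_le_abs (x n))
    rw [map_neg] at h2
    exact abs_le'.mpr ⟨apply_mono hf (le_abs_self (x n)), h2⟩
  have hinj : Function.Injective (topDualPairing ℝ E).flip := fun y z hyz => by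
    by_contra hne
    obtain ⟨f, hf⟩ := SeparatingDual.exists_separating_of_ne (R := ℝ) hne
    exact hf (DFunLike.congr_fun hyz f)
  refine (WeakBilin.tendsto_iff_forall_eval_tendsto _ hinj).mpr fun f => ?_
  obtain ⟨g, h, hg, hh, rfl⟩ := exists_pos_sub_pos f
  change Tendsto (fun n => (g - h) (x n)) atTop (𝓝 ((g - h) 0))
  simpa using (key g hg).sub (key h hh)

/-! ### From weakly null disjoint sequences to order continuity -/

omit [HasSolidNorm E] in
-- The second difference is -t⁻¹ times the first, so its positive part is dominated by the negative
-- part of the first.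
lemma disjoint_posPart_sub_smul [IsOrderedModule ℝ E] {a b : E} {t : ℝ} (ht : 1 ≤ t) :
    (a - t • b)⁺ ⊓ (b - t⁻¹ • a)⁺ = 0 := by
  have ht0 : 0 < t := one_pos.trans_le ht
  have h : (b - t⁻¹ • a)⁺ ≤ (a - t • b)⁻ := by
    have hn := negPart_nonneg (a - t • b)
    refine sup_le ?_ hn
    have e : b - t⁻¹ • a = t⁻¹ • -(a - t • b) := by
      rw [neg_sub, smul_sub, inv_smul_smul₀ ht0.ne']
    rw [e]
    exact (smul_le_smul_of_nonneg_left (neg_le_negPart _) (inv_nonneg.mpr ht0.le)).trans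
      (smul_le_of_le_one_left hn (inv_le_one_of_one_le₀ ht))
  exact inf_eq_zero_of_le (posPart_nonneg _) (posPart_nonneg _) le_rfl h
    (posPart_inf_negPart_eq_zero _)

/-- If a positive functional vanishes along bounded disjoint sequences, the unit ball is, up to a
small error for this functional, order bounded. -/
lemma exists_forall_apply_posPart_sub_le [IsOrderedModule ℝ E] [CompleteSpace E]
    {f : StrongDual ℝ E} (hf : ∀ x, 0 ≤ x → 0 ≤ f x)
    (h : ∀ v : ℕ → E, (∀ n, 0 ≤ v n) → (∀ n, ‖v n‖ ≤ 1) → (∀ m n, m ≠ n → v m ⊓ v n = 0) →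
      Tendsto (fun n => f (v n)) atTop (𝓝 0)) {ε : ℝ} (hε : 0 < ε) :
    ∃ u, 0 ≤ u ∧ ∀ x, 0 ≤ x → ‖x‖ ≤ 1 → f (x - u)⁺ ≤ ε := by
  by_contra! hcon
  choose! g hg0 hg1 hgε using hcon
  -- Each x n violates the bound for u = 4 ^ n • S n, where S n is the sum of the earlier x i.
  let S : ℕ → E := fun n => Nat.rec 0 (fun n s => s + g ((4 : ℝ) ^ n • s)) n
  let x : ℕ → E := fun n => g ((4 : ℝ) ^ n • S n)
  have hS : ∀ n, S (n + 1) = S n + x n := fun n => rfl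
  have hS0 : ∀ n, 0 ≤ S n := fun n => by
    induction n with
    | zero => exact le_rfl
    | succ n ih => exact add_nonneg ih (hg0 _ (smul_nonneg (by positivity) ih))
  have hS4 : ∀ n, 0 ≤ (4 : ℝ) ^ n • S n := fun n => smul_nonneg (by positivity) (hS0 n)
  have hx0 : ∀ n, 0 ≤ x n := fun n => hg0 _ (hS4 n)
  have hx1 : ∀ n, ‖x n‖ ≤ 1 := fun n => hg1 _ (hS4 n)
  have hSmono : Monotone S := monotone_nat_of_le_succ fun n => by
    rw [hS]; exact le_add_of_nonneg_right (hx0 n)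
  have hxS : ∀ n m, n < m → x n ≤ S m := fun n m hnm =>
    (le_add_of_nonneg_left (hS0 n)).trans ((hS n).ge.trans (hSmono hnm))
  have hsum : Summable fun n => (2⁻¹ : ℝ) ^ n • x n := by
    refine Summable.of_norm_bounded (summable_geometric_of_lt_one (by norm_num)
      (by norm_num : (2⁻¹ : ℝ) < 1)) fun n => ?_
    rw [norm_smul, norm_pow, Real.norm_of_nonneg (by norm_num : (0 : ℝ) ≤ 2⁻¹)]
    exact mul_le_of_le_one_right (by positivity) (hx1 n)
  let y : E := ∑' n, (2⁻¹ : ℝ) ^ n • x n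
  have hterm : ∀ n, 0 ≤ (2⁻¹ : ℝ) ^ n • x n := fun n => smul_nonneg (by positivity) (hx0 n)
  have hy0 : 0 ≤ y := tsum_nonneg hterm
  have hxy : ∀ n, (2⁻¹ : ℝ) ^ n • x n ≤ y := fun n => hsum.le_tsum n fun j _ => hterm j
  have hpy : ∀ n, 0 ≤ (2⁻¹ : ℝ) ^ n • y := fun n => smul_nonneg (by positivity) hy0
  -- For n < m, S m dominates x n and 2⁻ⁿ • y dominates 4⁻ᵐ • x m, which yields disjointness with t
  -- = 4 ^ m. The correction by y costs f only 2⁻ⁿ * f y, so f (v n) cannot tend to 0.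
  let v : ℕ → E := fun n => (x n - (4 : ℝ) ^ n • S n - (2⁻¹ : ℝ) ^ n • y)⁺
  have hv0 : ∀ n, 0 ≤ v n := fun n => posPart_nonneg _
  have hvx : ∀ n, v n ≤ x n := fun n =>
    sup_le ((sub_le_self _ (hpy n)).trans (sub_le_self _ (hS4 n))) (hx0 n)
  have hdisj : ∀ n m, n < m → v m ⊓ v n = 0 := fun n m hnm => by
    refine inf_eq_zero_of_le (hv0 m) (hv0 n) (posPart_mono ?_) (posPart_mono ?_)
      (disjoint_posPart_sub_smul (a := x m) (b := x n) (t := (4 : ℝ) ^ m)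
        (one_le_pow₀ (by norm_num)))
    · exact (sub_le_self _ (hpy m)).trans
        (sub_le_sub_left (smul_le_smul_of_nonneg_left (hxS n m hnm) (by positivity)) _)
    · refine sub_le_sub (sub_le_self _ (hS4 n)) ?_
      have hpow : ((4 : ℝ) ^ m)⁻¹ ≤ (2⁻¹) ^ n * (2⁻¹) ^ m := by
        rw [← inv_pow, show (4⁻¹ : ℝ) = 2⁻¹ * 2⁻¹ by norm_num, mul_pow]
        exact mul_le_mul_of_nonneg_right
          (pow_le_pow_of_le_one (by norm_num) (by norm_num) hnm.le) (by positivity)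
      calc ((4 : ℝ) ^ m)⁻¹ • x m ≤ ((2⁻¹ : ℝ) ^ n * (2⁻¹) ^ m) • x m :=
            smul_le_smul_of_nonneg_right hpow (hx0 m)
        _ = (2⁻¹ : ℝ) ^ n • (2⁻¹ : ℝ) ^ m • x m := mul_smul _ _ _
        _ ≤ (2⁻¹ : ℝ) ^ n • y := smul_le_smul_of_nonneg_left (hxy m) (by positivity)
  have hlim := h v hv0 (fun n => (norm_le_norm_of_nonneg_of_le (hv0 n) (hvx n)).trans (hx1 n))
    fun m n hmn => by
      rcases hmn.lt_or_gt with hlt | hlt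
      · rw [inf_comm]; exact hdisj m n hlt
      · exact hdisj n m hlt
  have hlim2 : Tendsto (fun n => f (v n) + (2⁻¹ : ℝ) ^ n * f y) atTop (𝓝 0) := by
    simpa using hlim.add ((tendsto_pow_atTop_nhds_zero_of_lt_one (by norm_num)
      (by norm_num : (2⁻¹ : ℝ) < 1)).mul_const (f y))
  refine absurd (ge_of_tendsto' hlim2 fun n => ?_) (not_le.mpr hε)
  have hle : (x n - (4 : ℝ) ^ n • S n)⁺ ≤ v n + (2⁻¹ : ℝ) ^ n • y := by
    have := posPart_add_le (x n - (4 : ℝ) ^ n • S n - (2⁻¹ : ℝ) ^ n • y) ((2⁻¹ : ℝ) ^ n • y)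
    rwa [sub_add_cancel, posPart_eq_self.mpr (hpy n)] at this
  have := apply_mono hf hle
  rw [map_add, map_smul, smul_eq_mul] at this
  exact (hgε _ (hS4 n)).le.trans this

/-- A downward directed set of functionals with infimum `0` converges to `0` pointwise on the
positive cone. -/
lemma exists_apply_lt_of_isGLB {D : Set (StrongDual ℝ E)} (hne : D.Nonempty)
    (hdir : DirectedOn (fun f g => (dualPartialOrder E).le g f) D)
    (hglb : letI := dualPartialOrder E; IsGLB D 0) {u : E} (hu : 0 ≤ u) {ε : ℝ} (hε : 0 < ε) :
    ∃ f ∈ D, f u < ε := by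
  have hpos : ∀ d : D, ∀ x, 0 ≤ x → 0 ≤ (d : StrongDual ℝ E) x := fun d x hx => hglb.1 d.2 x hx
  obtain ⟨f₀, hf₀⟩ := hne
  have : Nonempty D := ⟨⟨f₀, hf₀⟩⟩
  have hbdd : ∀ x, 0 ≤ x → BddBelow (Set.range fun d : D => (d : StrongDual ℝ E) x) :=
    fun x hx => ⟨0, by rintro _ ⟨d, rfl⟩; exact hpos d x hx⟩
  have hex : ∃ g : StrongDual ℝ E, ∀ x, 0 ≤ x → g x = ⨅ d : D, (d : StrongDual ℝ E) x := by
    refine exists_dual_of_additive _ ‖f₀‖ (fun x y hx hy => le_antisymm ?_ ?_) fun x hx => ?_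
    · refine le_ciInf_add_ciInf fun d e => ?_
      -- Directedness makes the pointwise infimum subadditive.
      obtain ⟨c, hc, hcd, hce⟩ := hdir d d.2 e e.2
      refine (ciInf_le (hbdd _ (add_nonneg hx hy)) ⟨c, hc⟩).trans ?_
      rw [map_add]
      exact add_le_add (hcd x hx) (hce y hy)
    · refine le_ciInf fun d => ?_
      rw [map_add]
      exact add_le_add (ciInf_le (hbdd x hx) d) (ciInf_le (hbdd y hy) d)
    · rw [abs_of_nonneg (le_ciInf fun d => hpos d x hx)]
      exact (ciInf_le (hbdd x hx) ⟨f₀, hf₀⟩).trans ((le_abs_self _).trans (f₀.le_opNorm x))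
  obtain ⟨g, hg⟩ := hex
  have hg0 : g u ≤ 0 := hglb.2 (fun d hd x hx => by
    rw [hg x hx]; exact ciInf_le (hbdd x hx) ⟨d, hd⟩) u hu
  rw [hg u hu] at hg0
  obtain ⟨d, hd⟩ := exists_lt_of_ciInf_lt (hg0.trans_lt hε)
  exact ⟨d, d.2, hd⟩

lemma dualHasOrderContinuousNorm_of_tendsto [IsOrderedModule ℝ E] [CompleteSpace E]
    (h : ∀ (f : StrongDual ℝ E) (v : ℕ → E), (∀ n, 0 ≤ v n) → (∀ n, ‖v n‖ ≤ 1) →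
      (∀ m n, m ≠ n → v m ⊓ v n = 0) → Tendsto (fun n => f (v n)) atTop (𝓝 0)) :
    DualHasOrderContinuousNorm E := by
  intro D hne hdir hglb ε hε
  have hpos : ∀ d ∈ D, ∀ x, 0 ≤ x → 0 ≤ d x := fun d hd x hx => hglb.1 hd x hx
  have hε3 : 0 < ε / 3 := by positivity
  obtain ⟨f₀, hf₀⟩ := hne
  obtain ⟨u, hu, hfu⟩ := exists_forall_apply_posPart_sub_le (hpos f₀ hf₀) (h f₀) hε3
  obtain ⟨f₁, hf₁, hf₁u⟩ := exists_apply_lt_of_isGLB ⟨f₀, hf₀⟩ hdir hglb hu hε3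
  -- Below f₂, the bound by f₁ handles u and the bound by f₀ handles the excess (x - u)⁺.
  obtain ⟨f₂, hf₂, h20, h21⟩ := hdir f₀ hf₀ f₁ hf₁
  refine ⟨f₂, hf₂, fun d hd hd2 => ?_⟩
  have hball : ∀ x, 0 ≤ x → ‖x‖ ≤ 1 → d x ≤ ε / 3 + ε / 3 := fun x hx hx1 => by
    have hp := posPart_nonneg (x - u)
    have hle : x ≤ u + (x - u)⁺ := sub_le_iff_le_add'.mp (le_posPart (x - u))
    have h1 := apply_mono (hpos d hd) hle
    rw [map_add] at h1
    have h2 := (hd2 u hu).trans (h21 u hu)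
    have h3 := ((hd2 _ hp).trans (h20 _ hp)).trans (hfu x hx hx1)
    linarith
  refine (norm_le_of_nonneg_of_le (add_pos hε3 hε3).le (hpos d hd) fun x hx => ?_).trans_lt
    (by linarith)
  rcases (norm_nonneg x).eq_or_lt with hx0 | hx0
  · rw [norm_eq_zero.mp hx0.symm]; simp
  · have := hball (‖x‖⁻¹ • x) (smul_nonneg (by positivity) hx)
      (by rw [norm_smul, norm_inv, norm_norm, inv_mul_cancel₀ hx0.ne'])
    rw [map_smul, smul_eq_mul, inv_mul_le_iff₀ hx0] at this
    linarith

end BanachLattice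

/-! ### Operators on ℓ¹ and the equivalence -/

/-- The operator on `ℓ¹` sending the unit vectors to a sequence in the unit ball. -/
lemma exists_lp_one_map_single {F : Type*} [NormedAddCommGroup F] [NormedSpace ℝ F]
    [CompleteSpace F] {v : ℕ → F} (hv : ∀ n, ‖v n‖ ≤ 1) :
    ∃ T : lp (fun _ : ℕ => ℝ) 1 →L[ℝ] F, ∀ n, T (lp.single 1 n 1) = v n := by
  have hnorm : ∀ a : lp (fun _ : ℕ => ℝ) 1, HasSum (fun n => ‖a n‖) ‖a‖ := fun a => by
    simpa using lp.hasSum_norm (p := 1) (by simp) a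
  have hle : ∀ (a : lp (fun _ : ℕ => ℝ) 1) n, ‖a n • v n‖ ≤ ‖a n‖ := fun a n => by
    rw [norm_smul]
    exact mul_le_of_le_one_right (norm_nonneg _) (hv n)
  have hsum : ∀ a : lp (fun _ : ℕ => ℝ) 1, Summable fun n => a n • v n := fun a =>
    Summable.of_norm_bounded (hnorm a).summable (hle a)
  let T : lp (fun _ : ℕ => ℝ) 1 →ₗ[ℝ] F :=
    { toFun := fun a => ∑' n, a n • v n
      map_add' := fun a b => by
        rw [← (hsum a).tsum_add (hsum b)]
        exact tsum_congr fun n => add_smul _ _ _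
      map_smul' := fun c a => by
        rw [RingHom.id_apply, ← (hsum a).tsum_const_smul]
        exact tsum_congr fun n => mul_smul _ _ _ }
  refine ⟨T.mkContinuous 1 fun a => ?_, fun n => ?_⟩
  · rw [one_mul]
    exact tsum_of_norm_bounded (hnorm a) (hle a)
  · change ∑' k, (lp.single 1 n (1 : ℝ) : lp (fun _ : ℕ => ℝ) 1) k • v k = v n
    rw [tsum_eq_single n fun k hk => by rw [lp.single_apply_ne _ _ _ hk, zero_smul],
      lp.single_apply_self, one_smul]

open BanachLattice in
theorem theorem3p6 (E : Type u) [NormedAddCommGroup E] [NormedSpace ℝ E] [CompleteSpace E]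
    [Lattice E] [IsOrderedAddMonoid E] [IsOrderedModule ℝ E] [HasSolidNorm E] :
    List.TFAE [
      ∀ (X : Type w) [NormedAddCommGroup X] [NormedSpace ℝ X] [CompleteSpace X] (T : X →L[ℝ] E),
        IsDisjointlyWeaklyCompactOperator T,
      ∀ T : lp (fun _ : ℕ => ℝ) 1 →L[ℝ] E, IsDisjointlyWeaklyCompactOperator T,
      DualHasOrderContinuousNorm E] := by
  tfae_have 1 → 2 := fun h T => by
    -- ℓ¹ lives in `Type 0`; an isometric copy in universe `w` has the same image of the unit ball.
    let e : ULift.{w} (lp (fun _ : ℕ => ℝ) 1) ≃ₗᵢ[ℝ] lp (fun _ : ℕ => ℝ) 1 :=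
      ⟨ULift.moduleEquiv, fun _ => rfl⟩
    have : CompleteSpace (ULift.{w} (lp (fun _ : ℕ => ℝ) 1)) :=
      (completeSpace_congr (e := e.toEquiv) e.isometry.isUniformEmbedding).mpr inferInstance
    have := h _ (T.comp (e : ULift.{w} (lp (fun _ : ℕ => ℝ) 1) →L[ℝ] lp (fun _ : ℕ => ℝ) 1))
    have himg : (T.comp (e : ULift.{w} (lp (fun _ : ℕ => ℝ) 1) →L[ℝ] lp (fun _ : ℕ => ℝ) 1)) ''
        Metric.closedBall 0 1 = T '' Metric.closedBall 0 1 := by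
      rw [ContinuousLinearMap.coe_comp, Set.image_comp]
      congr 1
      simp
    unfold IsDisjointlyWeaklyCompactOperator at this ⊢
    rwa [himg] at this
  tfae_have 2 → 3 := fun h => by
    refine dualHasOrderContinuousNorm_of_tendsto fun f v hv0 hv1 hd => ?_
    obtain ⟨T, hT⟩ := exists_lp_one_map_single hv1
    have hw := (h T).2 v (fun n => ⟨v n, ⟨lp.single 1 n 1, by simp, hT n⟩, le_rfl⟩)
      (fun m n hmn => by
        rw [abs_of_nonneg (hv0 m), abs_of_nonneg (hv0 n)]; exact hd m n hmn)
    have hcont : Continuous fun z : WeakSpace ℝ E => (topDualPairing ℝ E).flip z f :=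
      WeakBilin.eval_continuous _ f
    exact (hcont.tendsto' 0 0 (map_zero f)).comp hw
  tfae_have 3 → 1 := fun hE X _ _ _ T => by
    have hb : ∀ z ∈ T '' Metric.closedBall (0 : X) 1, ‖z‖ ≤ ‖T‖ := by
      rintro _ ⟨y, hy, rfl⟩
      exact T.unit_le_opNorm y (mem_closedBall_zero_iff.mp hy)
    refine ⟨isBounded_iff_forall_norm_le.mpr ⟨‖T‖, hb⟩, fun x hx hd => ?_⟩
    refine tendsto_weak_of_isDisjointSeq hE (C := ‖T‖) (fun n => ?_) hd
    obtain ⟨z, hz, hxz⟩ := hx n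
    exact (norm_le_norm_of_abs_le_abs hxz).trans (hb z hz)
  tfae_finish
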